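/- Let $d,m\ge 0$ be integers. A \emph{cell label} is a tuple $z=(z_1\cdots z_d)$ with entries in $\{\bullet,+,-\}$, where $\pm$ is identified with $\pm1$. Its \emph{dual cell} is $$P^\vee_z=\{x\in\mathbb R^d : x_i=0 \text{ if } z_i=\bullet,\ x_i\in[0,1]\text{ if } z_i=+,\ x_i\in[-1,0]\text{ if } z_i=-\},$$ which has dimension $d$ minus the number of entries $\bullet$. Let $\vec b_i\in\mathbb R^d$ be the vectors with $(\vec b_i)_j=1/j^{\,i-1}$. For $\varepsilon>0$ and $\epsilon_{m+1}>0$ let $$\tilde P^{\vee,\mathrm{thick}}_{z}(\epsilon_{m+1})=[-1,1]^d\cap\Big\{\sum_{i=1}^{m}\epsilon_i\vec b_i+\epsilon_{m+1}\vec b_{m+1}+\sum_{j:\,z_j\ne\bullet}z_jt_j\mathbf e_j \;:\; t_j\ge 0,\ -\varepsilon\le\epsilon_i\le\varepsilon \text{ for } 1\le i\le m\Big\}.$$ Let $z',z''$ be cell labels with $p$ and $q$ entries $\bullet$ respectively, so that $P^\vee_{z'}$ is a dual $(d-p)$-cell and $P^\vee_{z''}$ a dual $(d-q)$-cell. Let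 $\lambda_1<\cdots<\lambda_r$ be the coordinates where both labels are $\bullet$, and $\hat\lambda_1<\hat\lambda_2<\cdots<\hat\lambda_{p+q-2r}$ those where exactly one of them is. For each $\ell$ let $k(\ell)$ be such that $\lambda_{k(\ell)-1}<\hat\lambda_\ell<\lambda_{k(\ell)}$, with $\lambda_0=0$, $\lambda_{r+1}=\infty$. Limits of sets are closed limits in the Hausdorff distance (a family converges to $\emptyset$ iff it is eventually empty), and the dimension of a set is that of its affine span, with $\dim\emptyset=-\infty$. Then the iterated limit $$L=\lim_{\varepsilon\to0^+}\ \lim_{\epsilon_{m+1}\to0^+}\ P^\vee_{z'}\cap\tilde P^{\vee,\mathrm{thick}}_{z''}(\epsilon_{m+1})$$ exists and is unique, and: \begin{enumerate} \item If $r\ne m$, then $L$ is empty or $\dim L<d-p-q+m$. \item If $r=m$ and $\{z'_k,z''_k\}=\{+,-\}$ for some $k$, then $\dim L<d-p-q+m$ (where $L$ may be empty). \item Suppose $r=m$ and $\{z'_k,z''_k\}\ne\{+,-\}$ for all $k$. \begin{enumerate} \item If for every $\ell$ we have $z''_{\hat\lambda_\ell}=-(-1)^{k(\ell)-1}$ when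 $z'_{\hat\lambda_\ell}=\bullet$, and $z'_{\hat\lambda_\ell}=+(-1)^{k(\ell)-1}$ when $z''_{\hat\lambda_\ell}=\bullet$, then $L=P^\vee_z$, where $z_k=\bullet$ if $z'_k=\bullet$ or $z''_k=\bullet$, and $z_k=z'_k=z''_k$ otherwise; this $z$ has $p+q-m$ entries $\bullet$, and $\dim L=d-p-q+m$. \item Otherwise $L=\emptyset$. \end{enumerate} \end{enumerate} In particular, $\dim L=d-p-q+m$ if and only if $r=m$, $\{z'_k,z''_k\}\neq\{+,-\}$ for all $k$, and the sign pattern of (3a) holds. Moreover, for a cell label $z$ let $\mathrm{Int}_m(z)$ be the set of pairs $(z',z'')$ for which there are coordinates $i_1<\cdots<i_m$ with $z_{i_s}=z'_{i_s}=z''_{i_s}=\bullet$ for all $s$, such that for every other coordinate $j$: if $z_j=\bullet$, then $(z'_j,z''_j)\in\{(+(-1)^{\ell(j)},\bullet),(\bullet,-(-1)^{\ell(j)})\}$ with $\ell(j)=\#\{s: i_s<j\}$; and if $z_j=\pm$, then $z'_j=z''_j=z_j$. Then $(z',z'')\in\mathrm{Int}_m(z)$ if and only if $L=P^\vee_z$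 and $\dim L=d-p-q+m$. -/

import Mathlib

open Filter Topology

namespace CubicalCup

/-- The three possible entries `•`, `+`, `-` of the label of a cell of the cube. -/
inductive CellLabel : Type
  | bullet : CellLabel
  | plus : CellLabel
  | minus : CellLabel
  deriving DecidableEq

namespace CellLabel

/-- The numerical value of a label: `+` is `1`, `-` is `-1` (and `•` is given the value `0`). -/
def val : CellLabel → ℝ
  | bullet => 0
  | plus => 1
  | minus => -1

/-- Exchange of `+` and `-`. -/
def flip : CellLabel → CellLabel
  | bullet => bullet
  | plus => minus
  | minus => plus

/-- The label `(-1)^n · +`. -/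
def signPow (n : ℕ) : CellLabel := if Even n then plus else minus

/-- The unordered pair of labels is `{+, -}`. -/
def Opposite (a b : CellLabel) : Prop :=
  (a = plus ∧ b = minus) ∨ (a = minus ∧ b = plus)

end CellLabel

open CellLabel

/-- The label `(z_1 ⋯ z_d)` of a cell of the `d`-cube. The coordinates `1, …, d` are indexed by
`Fin d`, so that `j : Fin d` stands for the coordinate `j + 1`. -/
abbrev Cell (d : ℕ) : Type := Fin d → CellLabel

/-- The coordinates at which a label is `•`. -/
def bullets {d : ℕ} (z : Cell d) : Finset (Fin d) :=
  Finset.univ.filter fun j => z j = bullet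

/-- The coordinates at which both labels are `•`. -/
def shared {d : ℕ} (z' z'' : Cell d) : Finset (Fin d) := bullets z' ∩ bullets z''

/-- The coordinates at which exactly one of the two labels is `•`. -/
def unshared {d : ℕ} (z' z'' : Cell d) : Finset (Fin d) :=
  (bullets z' ∪ bullets z'') \ shared z' z''

/-- For `S = {λ_1 < ⋯ < λ_r}` and `j ∉ S`, the position `k ∈ {1, …, r + 1}` with
`λ_{k-1} < j < λ_k`, where `λ_0 = 0` and `λ_{r+1} = ∞`. -/
def position {d : ℕ} (S : Finset (Fin d)) (j : Fin d) : ℕ :=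
  (S.filter fun i => i < j).card + 1

/-- The cube `[-1,1]^d`. -/
def cube (d : ℕ) : Set (Fin d → ℝ) := {x | ∀ j, x j ∈ Set.Icc (-1 : ℝ) 1}

/-- The dual cell of the cell with label `z`. -/
def dualCell {d : ℕ} (z : Cell d) : Set (Fin d → ℝ) :=
  {x | ∀ j, (z j = bullet → x j = 0) ∧ (z j = plus → x j ∈ Set.Icc (0 : ℝ) 1) ∧
    (z j = minus → x j ∈ Set.Icc (-1 : ℝ) 0)}

/-- The frame vector `b_{i+1}`, whose coordinate `j + 1` is `1 / (j + 1)^i`. -/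
noncomputable def frame (d i : ℕ) : Fin d → ℝ := fun j => 1 / ((j : ℝ) + 1) ^ i

/-- The dual cell of `z`, thickened along `b_1, …, b_m` up to the parameter `ε` in both
directions, and shifted by `δ b_{m+1}`. -/
noncomputable def thickDualCell {d : ℕ} (m : ℕ) (z : Cell d) (ε δ : ℝ) : Set (Fin d → ℝ) :=
  cube d ∩ {x | ∃ (e : Fin m → ℝ) (t : Fin d → ℝ),
    (∀ i, -ε ≤ e i ∧ e i ≤ ε) ∧ (∀ j, 0 ≤ t j) ∧
    x = ∑ i : Fin m, e i • frame d i + δ • frame d m +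
      ∑ j ∈ Finset.univ.filter (fun j => z j ≠ bullet),
        ((z j).val * t j) • (Pi.single j (1 : ℝ) : Fin d → ℝ)}

/-- Convergence of a family of subsets of `ℝ^d` to the closed set `L` in the Hausdorff distance.
The empty set has infinite distance to every other set, so a family converges to `∅` exactly when
it is eventually empty. (All norms of `ℝ^d` give the same notion.) -/
def SetTendsto {d : ℕ} (A : ℝ → Set (Fin d → ℝ)) (l : Filter ℝ) (L : Set (Fin d → ℝ)) : Prop :=
  IsClosed L ∧ Tendsto (fun s => Metric.hausdorffEDist (A s) L) l (𝓝 0)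

/-- `L = lim_{ε → 0⁺} lim_{δ → 0⁺} A ε δ`, where the inner limit exists for every `ε > 0`. -/
def IsIteratedLimit {d : ℕ} (A : ℝ → ℝ → Set (Fin d → ℝ)) (L : Set (Fin d → ℝ)) : Prop :=
  ∃ B : ℝ → Set (Fin d → ℝ),
    (∀ ε : ℝ, 0 < ε → SetTendsto (A ε) (𝓝[>] 0) (B ε)) ∧ SetTendsto B (𝓝[>] 0) L

/-- `L = lim_{ε → 0⁺} lim_{δ → 0⁺} P^∨_{z'} ∩ P̃^{∨,thick}_{z''}(δ)`. -/
def IsThickIntersection {d : ℕ} (m : ℕ) (z' z'' : Cell d) (L : Set (Fin d → ℝ)) : Prop :=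
  IsIteratedLimit (fun ε δ => dualCell z' ∩ thickDualCell m z'' ε δ) L

open Classical in
/-- The dimension of the affine span of a set; the empty set has dimension `⊥` (that is, `-∞`).
For convex sets, such as the cells and the limits of their intersections, this is the usual
dimension. -/
noncomputable def affineDim {d : ℕ} (S : Set (Fin d → ℝ)) : WithBot ℤ :=
  if S = ∅ then ⊥ else ((Module.finrank ℝ (vectorSpan ℝ S) : ℤ) : WithBot ℤ)

/-- The label that is `•` where one of the two labels is, and equals the first one elsewhere. -/
def combine {d : ℕ} (z' z'' : Cell d) : Cell d :=
  fun k => if z' k = bullet ∨ z'' k = bullet then bullet else z' k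

/-- The alternating sign pattern: at each coordinate `j` where exactly one label is `•`, with
position `k` relative to the shared `•` coordinates, `z''_j = -(-1)^{k-1}` if `z'_j = •`, and
`z'_j = +(-1)^{k-1}` if `z''_j = •`. -/
def SignPattern {d : ℕ} (z' z'' : Cell d) : Prop :=
  ∀ j ∈ unshared z' z'',
    (z' j = bullet → z'' j = (signPow (position (shared z' z'') j - 1)).flip) ∧
    (z'' j = bullet → z' j = signPow (position (shared z' z'') j - 1))

/-- The set `Int_m(z)` of pairs of cells: there are `i_1 < ⋯ < i_m` among the `•` coordinates of
`z` at which both cells have `•`; at every other `•` coordinate `j` of `z`, with `ℓ` of the `i`'s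
below `j`, the pair of labels is `((-1)^ℓ +, •)` or `(•, (-1)^ℓ -)`; and at each `±` coordinate
of `z` both cells agree with `z`. -/
def IntSet {d : ℕ} (m : ℕ) (z : Cell d) : Set (Cell d × Cell d) :=
  {w | ∃ S : Finset (Fin d), S.card = m ∧
    (∀ i ∈ S, z i = bullet ∧ w.1 i = bullet ∧ w.2 i = bullet) ∧
    ∀ j, j ∉ S →
      (z j = bullet →
        (w.1 j = signPow (S.filter fun i => i < j).card ∧ w.2 j = bullet) ∨
        (w.1 j = bullet ∧ w.2 j = (signPow (S.filter fun i => i < j).card).flip)) ∧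
      (z j ≠ bullet → w.1 j = z j ∧ w.2 j = z j)}

end CubicalCup

/-! The coordinates of `∑ e_i b_i + δ b_{m+1}` are the values, at the decreasing nodes `1, 1/2, 1/3,
…`, of a polynomial of degree `m` with leading coefficient `δ`. A point common to the two cells
forces this polynomial to vanish at the shared bullets and prescribes its weak sign at the unshared
ones. For `δ > 0` it has at most `m` zeros, so `r ≤ m`. If `r = m`, it is `δ` times the product of
the linear factors at the shared nodes, whose sign at any other node is `(-1)` to the number of
shared bullets below it; this is the alternating sign pattern. Conversely, with no opposite signs,
the pattern makes this product a solution.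

Hence there is a dichotomy. If no slice with `δ > 0` has a point, then `L = ∅`
(`isThickIntersection_empty`). If one has, joint convexity of the slices in the point and the
parameters shows that nothing is lost in the limit, and `L` is all of `P^∨_{z'} ∩ P^∨_{z''}`
(`Feasible.isThickIntersection`). That intersection is again a dual cell, with bullets at the union
of the bullets and at the opposite signs. Its dimension is therefore at most `d - p - q + r`, with
equality exactly when no signs are opposite, and counting with `r ≤ m` gives every case. -/

namespace CubicalCup

open CellLabel

/-! ### Slices as linear systems: joint convexity and compactness. -/

section Slices

variable {d m : ℕ}

/-- The node `1 / (j + 1)` at which the polynomials built from the frame are evaluated. -/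
noncomputable def node (j : Fin d) : ℝ := 1 / ((j : ℝ) + 1)

/-- The coordinates of `∑ e_i b_i + δ b_{m+1}`: the values at the nodes of the polynomial with
lower coefficients `e` and leading coefficient `δ`. -/
noncomputable def shift (e : Fin m → ℝ) (δ : ℝ) (j : Fin d) : ℝ :=
  ∑ i : Fin m, e i * node j ^ (i : ℕ) + δ * node j ^ m

/-- `P^∨_{z'} ∩ P̃^{∨,thick}_{z''}`, described by linear equations and inequalities. -/
def slice (m : ℕ) (z' z'' : Cell d) (ε δ : ℝ) : Set (Fin d → ℝ) :=
  {x | x ∈ dualCell z' ∧ ∃ e : Fin m → ℝ, (∀ i, -ε ≤ e i ∧ e i ≤ ε) ∧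
    ∀ j, (z'' j = bullet → x j = shift e δ j) ∧ (z'' j = plus → shift e δ j ≤ x j) ∧
      (z'' j = minus → x j ≤ shift e δ j)}

/-- Some slice with positive leading coefficient is nonempty. -/
def Feasible (m : ℕ) (z' z'' : Cell d) : Prop :=
  ∃ δ > 0, ∃ ε, (slice m z' z'' ε δ).Nonempty

lemma dualCell_subset_cube (z : Cell d) : dualCell z ⊆ cube d := by
  intro x hx j
  obtain ⟨h0, h1, h2⟩ := hx j
  rcases h : z j with _ | _ | _
  · simp [h0 h]
  · have := h1 h
    exact ⟨by linarith [this.1], this.2⟩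
  · have := h2 h
    exact ⟨this.1, by linarith [this.2]⟩

lemma frame_apply (i : ℕ) (j : Fin d) : frame d i j = node j ^ i := by
  simp [frame, node]

lemma frame_combination_apply (z : Cell d) (e : Fin m → ℝ) (δ : ℝ) (t : Fin d → ℝ) (j : Fin d) :
    (∑ i : Fin m, e i • frame d i + δ • frame d m +
      ∑ j ∈ Finset.univ.filter (fun j => z j ≠ bullet),
        ((z j).val * t j) • (Pi.single j (1 : ℝ) : Fin d → ℝ)) j
      = shift e δ j + (z j).val * t j := by
  have h : (∑ k ∈ Finset.univ.filter (fun k => z k ≠ bullet),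
      ((z k).val * t k) • (Pi.single k (1 : ℝ) : Fin d → ℝ)) j = (z j).val * t j := by
    rw [Finset.sum_apply, Finset.sum_filter]
    rw [Finset.sum_eq_single j]
    · by_cases hj : z j = bullet <;> simp [hj, val]
    · intro k _ hk
      simp [Pi.single_eq_of_ne hk.symm]
    · simp
  rw [Pi.add_apply, Pi.add_apply, h, Finset.sum_apply]
  simp [shift, frame_apply]

lemma dualCell_inter_thickDualCell (m : ℕ) (z' z'' : Cell d) (ε δ : ℝ) :
    dualCell z' ∩ thickDualCell m z'' ε δ = slice m z' z'' ε δ := by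
  ext x
  constructor
  · rintro ⟨hx, -, e, t, he, ht, rfl⟩
    refine ⟨hx, e, he, fun j => ?_⟩
    rw [frame_combination_apply]
    have := ht j
    refine ⟨fun h => ?_, fun h => ?_, fun h => ?_⟩ <;> simp [h, val, this]
  · rintro ⟨hx, e, he, h⟩
    -- The parameter `t` is recovered from `z_j² = 1`; the cube condition is automatic on a dual
    -- cell.
    refine ⟨hx, dualCell_subset_cube _ hx, e, fun j => (z'' j).val * (x j - shift e δ j), he,
      fun j => ?_, ?_⟩
    · obtain ⟨-, h1, h2⟩ := h j
      rcases hz : z'' j with _ | _ | _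
      · simp [hz, val]
      · simpa [hz, val] using h1 hz
      · simpa [hz, val] using h2 hz
    · funext j
      rw [frame_combination_apply]
      rcases hz : z'' j with _ | _ | _
      · simp [val, (h j).1 hz]
      · simp [val]
      · simp [val]

lemma shift_combination (e f : Fin m → ℝ) (δ η a b : ℝ) (j : Fin d) :
    shift (a • e + b • f) (a * δ + b * η) j = a * shift e δ j + b * shift f η j := by
  simp only [shift, Pi.add_apply, Pi.smul_apply, smul_eq_mul, add_mul, Finset.sum_add_distrib,
    mul_add, Finset.mul_sum, mul_assoc]
  ring

lemma convex_dualCell (z : Cell d) : Convex ℝ (dualCell z) := by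
  intro x hx y hy a b ha hb hab j
  obtain ⟨hx0, hx1, hx2⟩ := hx j
  obtain ⟨hy0, hy1, hy2⟩ := hy j
  refine ⟨fun h => ?_, fun h => ?_, fun h => ?_⟩
  · simp [hx0 h, hy0 h]
  · exact convex_Icc (0 : ℝ) 1 (hx1 h) (hy1 h) ha hb hab
  · exact convex_Icc (-1 : ℝ) 0 (hx2 h) (hy2 h) ha hb hab

/-- All conditions are linear in the point, the coefficients and both parameters together, so slices
with different parameters can be interpolated. -/
lemma slice_combination {z' z'' : Cell d} {ε₁ ε₂ δ₁ δ₂ a b : ℝ} {x y : Fin d → ℝ}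
    (hx : x ∈ slice m z' z'' ε₁ δ₁) (hy : y ∈ slice m z' z'' ε₂ δ₂)
    (ha : 0 ≤ a) (hb : 0 ≤ b) (hab : a + b = 1) :
    a • x + b • y ∈ slice m z' z'' (a * ε₁ + b * ε₂) (a * δ₁ + b * δ₂) := by
  obtain ⟨hx, e, he, h⟩ := hx
  obtain ⟨hy, f, hf, k⟩ := hy
  refine ⟨convex_dualCell z' hx hy ha hb hab, a • e + b • f, fun i => ?_, fun j => ?_⟩
  · have h1 := mul_le_mul_of_nonneg_left (he i).1 ha
    have h2 := mul_le_mul_of_nonneg_left (he i).2 ha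
    have h3 := mul_le_mul_of_nonneg_left (hf i).1 hb
    have h4 := mul_le_mul_of_nonneg_left (hf i).2 hb
    simp only [Pi.add_apply, Pi.smul_apply, smul_eq_mul]
    constructor <;> linarith
  · rw [shift_combination]
    simp only [Pi.add_apply, Pi.smul_apply, smul_eq_mul]
    refine ⟨fun hz => ?_, fun hz => ?_, fun hz => ?_⟩
    · rw [(h j).1 hz, (k j).1 hz]
    · exact add_le_add (mul_le_mul_of_nonneg_left ((h j).2.1 hz) ha)
        (mul_le_mul_of_nonneg_left ((k j).2.1 hz) hb)
    · exact add_le_add (mul_le_mul_of_nonneg_left ((h j).2.2 hz) ha)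
        (mul_le_mul_of_nonneg_left ((k j).2.2 hz) hb)

lemma slice_mono {z' z'' : Cell d} {ε ε' δ : ℝ} (h : ε ≤ ε') :
    slice m z' z'' ε δ ⊆ slice m z' z'' ε' δ := by
  rintro x ⟨hx, e, he, hj⟩
  exact ⟨hx, e, fun i => ⟨by linarith [(he i).1], (he i).2.trans h⟩, hj⟩

lemma zero_mem_dualCell (z : Cell d) : (0 : Fin d → ℝ) ∈ dualCell z := by
  intro j
  simp

lemma slice_zero_zero (m : ℕ) (z' z'' : Cell d) :
    slice m z' z'' 0 0 = dualCell z' ∩ dualCell z'' := by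
  have h0 : ∀ e : Fin m → ℝ, (∀ i, -(0 : ℝ) ≤ e i ∧ e i ≤ 0) →
      ∀ j : Fin d, shift e 0 j = 0 := by
    intro e he j
    have : e = 0 := funext fun i => le_antisymm (he i).2 (by simpa using (he i).1)
    simp [shift, this]
  ext x
  constructor
  · rintro ⟨hx, e, he, h⟩
    refine ⟨hx, fun j => ?_⟩
    have hj := h j
    -- The slice bounds `x j` by the shift on one side only; the outer bound `±1` comes from the
    -- first cell.
    have hc := dualCell_subset_cube _ hx j
    rw [h0 e he j] at hj
    exact ⟨hj.1, fun hz => ⟨hj.2.1 hz, hc.2⟩, fun hz => ⟨hc.1, hj.2.2 hz⟩⟩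
  · rintro ⟨hx, hy⟩
    refine ⟨hx, 0, by simp, fun j => ?_⟩
    rw [h0 0 (by simp) j]
    exact ⟨(hy j).1, fun hz => ((hy j).2.1 hz).1, fun hz => ((hy j).2.2 hz).2⟩

lemma zero_mem_slice (m : ℕ) (z' z'' : Cell d) : (0 : Fin d → ℝ) ∈ slice m z' z'' 0 0 := by
  rw [slice_zero_zero]
  exact ⟨zero_mem_dualCell _, zero_mem_dualCell _⟩

/-- Shrinking a feasible point towards the origin, which lies in the slice at `(0, 0)`, makes its
coefficients as small as desired and keeps `δ` positive. -/
lemma Feasible.exists_slice_nonempty {z' z'' : Cell d} (h : Feasible m z' z'') {ε : ℝ}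
    (hε : 0 < ε) : ∃ δ > 0, (slice m z' z'' ε δ).Nonempty := by
  obtain ⟨δ, hδ, ε₀, x, hx⟩ := h
  have hx := slice_mono (le_max_left ε₀ ε) hx
  have hM : 0 < max ε₀ ε := hε.trans_le (le_max_right _ _)
  have hs : 0 < ε / max ε₀ ε := div_pos hε hM
  have hs1 : ε / max ε₀ ε ≤ 1 := (div_le_one hM).2 (le_max_right _ _)
  have := slice_combination (zero_mem_slice m z' z'') hx (sub_nonneg.2 hs1) hs.le (by ring)
  rw [div_mul_cancel₀ _ hM.ne', mul_zero, zero_add, zero_add] at this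
  refine ⟨(ε / max ε₀ ε) * δ, mul_pos hs hδ, _, this⟩

lemma isClosed_dualCell (z : Cell d) : IsClosed (dualCell z) := by
  simp only [dualCell, Set.ofPred_forall, Set.ofPred_and]
  refine isClosed_iInter fun j => IsClosed.inter ?_ (IsClosed.inter ?_ ?_)
  · exact isClosed_iInter fun _ => isClosed_eq (continuous_apply j) continuous_const
  · exact isClosed_iInter fun _ => isClosed_Icc.preimage (continuous_apply j)
  · exact isClosed_iInter fun _ => isClosed_Icc.preimage (continuous_apply j)

/-- Fibres of a compact set are upper semicontinuous. -/
lemma eventually_fiber_subset {X Y : Type*} [TopologicalSpace X] [T2Space X] [TopologicalSpace Y]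
    {K : Set (X × Y)} (hK : IsCompact K) (x₀ : X) {U : Set Y} (hU : IsOpen U)
    (h : ∀ y, (x₀, y) ∈ K → y ∈ U) : ∀ᶠ x in 𝓝 x₀, ∀ y, (x, y) ∈ K → y ∈ U := by
  have hC : IsCompact (K \ Prod.snd ⁻¹' U) := hK.diff (hU.preimage continuous_snd)
  have hI : IsClosed (Prod.fst '' (K \ Prod.snd ⁻¹' U)) := (hC.image continuous_fst).isClosed
  have hx : x₀ ∉ Prod.fst '' (K \ Prod.snd ⁻¹' U) := by
    rintro ⟨⟨_, y⟩, ⟨hy, hn⟩, rfl⟩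
    exact hn (h y hy)
  filter_upwards [hI.isOpen_compl.mem_nhds hx] with x hx y hy
  by_contra hn
  exact hx ⟨(x, y), ⟨hy, hn⟩, rfl⟩

/-- The slices with their parameters and coefficients. -/
def sliceGraph (m : ℕ) (z' z'' : Cell d) : Set ((ℝ × ℝ) × ((Fin d → ℝ) × (Fin m → ℝ))) :=
  {w | w.2.1 ∈ dualCell z' ∧ (∀ i, -w.1.1 ≤ w.2.2 i ∧ w.2.2 i ≤ w.1.1) ∧
    ∀ j, (z'' j = bullet → w.2.1 j = shift w.2.2 w.1.2 j) ∧
      (z'' j = plus → shift w.2.2 w.1.2 j ≤ w.2.1 j) ∧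
      (z'' j = minus → w.2.1 j ≤ shift w.2.2 w.1.2 j)}

lemma mem_slice_iff {z' z'' : Cell d} {ε δ : ℝ} {x : Fin d → ℝ} :
    x ∈ slice m z' z'' ε δ ↔ ∃ e : Fin m → ℝ, ((ε, δ), (x, e)) ∈ sliceGraph m z' z'' := by
  simp only [slice, sliceGraph, Set.mem_ofPred_eq]
  constructor
  · rintro ⟨h, e, h1, h2⟩
    exact ⟨e, h, h1, h2⟩
  · rintro ⟨e, h, h1, h2⟩
    exact ⟨h, e, h1, h2⟩

lemma isClosed_sliceGraph (m : ℕ) (z' z'' : Cell d) : IsClosed (sliceGraph m z' z'') := by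
  have hs : ∀ j : Fin d, Continuous
      fun w : (ℝ × ℝ) × ((Fin d → ℝ) × (Fin m → ℝ)) => shift w.2.2 w.1.2 j := by
    intro j
    unfold shift
    fun_prop
  have hx : ∀ j : Fin d, Continuous
      fun w : (ℝ × ℝ) × ((Fin d → ℝ) × (Fin m → ℝ)) => w.2.1 j := by
    intro j
    fun_prop
  simp only [sliceGraph, Set.ofPred_forall, Set.ofPred_and]
  refine IsClosed.inter ((isClosed_dualCell z').preimage (by fun_prop)) (IsClosed.inter ?_ ?_)
  · refine isClosed_iInter fun i => IsClosed.inter ?_ ?_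
    · exact isClosed_le (by fun_prop) (by fun_prop)
    · exact isClosed_le (by fun_prop) (by fun_prop)
  · refine isClosed_iInter fun j => IsClosed.inter ?_ (IsClosed.inter ?_ ?_)
    · exact isClosed_iInter fun _ => isClosed_eq (hx j) (hs j)
    · exact isClosed_iInter fun _ => isClosed_le (hs j) (hx j)
    · exact isClosed_iInter fun _ => isClosed_le (hx j) (hs j)

lemma isCompact_sliceGraph_inter (m : ℕ) (z' z'' : Cell d) (w : ℝ × ℝ) :
    IsCompact (sliceGraph m z' z'' ∩ Prod.fst ⁻¹' Metric.closedBall w 1) := by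
  have hc : IsCompact (Metric.closedBall w 1 ×ˢ
      ((Set.Icc (fun _ => -1) (fun _ => 1) : Set (Fin d → ℝ)) ×ˢ
        (Set.Icc (fun _ => -(w.1 + 1)) (fun _ => w.1 + 1) : Set (Fin m → ℝ)))) :=
    (isCompact_closedBall w 1).prod (isCompact_Icc.prod isCompact_Icc)
  refine hc.of_isClosed_subset ((isClosed_sliceGraph m z' z'').inter
    (Metric.isClosed_closedBall.preimage continuous_fst)) ?_
  rintro ⟨v, x, e⟩ ⟨⟨hx, he, -⟩, hv⟩
  have hx := dualCell_subset_cube _ hx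
  have hv1 : v.1 ≤ w.1 + 1 := by
    have h1 : dist v w ≤ 1 := hv
    rw [Prod.dist_eq] at h1
    have h2 := (le_max_left _ _).trans h1
    rw [Real.dist_eq] at h2
    linarith [le_abs_self (v.1 - w.1)]
  exact ⟨hv, ⟨fun j => (hx j).1, fun j => (hx j).2⟩,
    ⟨fun i => by linarith [(he i).1], fun i => (he i).2.trans hv1⟩⟩

/-- One half of Hausdorff convergence, which follows from compactness alone. Only the other half can
fail, and it is there that feasibility enters. -/
lemma eventually_slice_subset_thickening (m : ℕ) (z' z'' : Cell d) (w : ℝ × ℝ) {η : ℝ}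
    (hη : 0 < η) : ∀ᶠ v in 𝓝 w,
      slice m z' z'' v.1 v.2 ⊆ Metric.thickening η (slice m z' z'' w.1 w.2) := by
  have := eventually_fiber_subset (isCompact_sliceGraph_inter m z' z'' w) w
    (U := Prod.fst ⁻¹' Metric.thickening η (slice m z' z'' w.1 w.2))
    (Metric.isOpen_thickening.preimage continuous_fst) (by
      rintro ⟨x, e⟩ ⟨h, -⟩
      exact Metric.self_subset_thickening hη _ (mem_slice_iff.2 ⟨e, h⟩))
  filter_upwards [this, Metric.closedBall_mem_nhds w one_pos] with v hv hb x hx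
  obtain ⟨e, he⟩ := mem_slice_iff.1 hx
  exact hv (x, e) ⟨he, hb⟩

/-- Forgetting the coefficients preserves closedness because they range over a compact set. -/
lemma isClosed_slice (m : ℕ) (z' z'' : Cell d) (ε δ : ℝ) : IsClosed (slice m z' z'' ε δ) := by
  have hc := (isCompact_sliceGraph_inter m z' z'' (ε, δ)).inter_right
    (isClosed_singleton (x := (ε, δ)) |>.preimage continuous_fst)
  have := (hc.image (f := fun w => w.2.1) (by fun_prop)).isClosed
  convert this using 1
  ext x
  rw [mem_slice_iff]
  constructor
  · rintro ⟨e, he⟩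
    exact ⟨_, ⟨⟨he, Metric.mem_closedBall_self zero_le_one⟩, rfl⟩, rfl⟩
  · rintro ⟨⟨v, y, e⟩, ⟨⟨he, -⟩, hv⟩, rfl⟩
    obtain rfl : v = (ε, δ) := hv
    exact ⟨e, he⟩

end Slices

/-! ### Hausdorff limits of the slices. -/

section Limits

variable {d m : ℕ}

lemma setTendsto_of_thickening {A : ℝ → Set (Fin d → ℝ)} {l : Filter ℝ} {L : Set (Fin d → ℝ)}
    (hL : IsClosed L) (h₁ : ∀ η > 0, ∀ᶠ s in l, A s ⊆ Metric.thickening η L)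
    (h₂ : ∀ η > 0, ∀ᶠ s in l, L ⊆ Metric.thickening η (A s)) : SetTendsto A l L := by
  refine ⟨hL, ENNReal.tendsto_nhds_zero.2 fun c hc => ?_⟩
  -- The bound `c` may be infinite, so a finite radius below it is chosen.
  obtain ⟨η, hη, hηc⟩ := ENNReal.lt_iff_exists_nnreal_btwn.1 hc
  have hη : (0 : ℝ) < η := by exact_mod_cast hη
  filter_upwards [h₁ η hη, h₂ η hη] with s hs hs'
  have key : ∀ {S T : Set (Fin d → ℝ)}, S ⊆ Metric.thickening η T →
      ∀ x ∈ S, ∃ y ∈ T, edist x y ≤ c := by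
    intro S T hST x hx
    obtain ⟨y, hy, hxy⟩ := Metric.mem_thickening_iff.1 (hST hx)
    refine ⟨y, hy, ?_⟩
    rw [edist_dist]
    refine le_trans (ENNReal.ofReal_le_ofReal hxy.le) ?_
    simpa using hηc.le
  exact Metric.hausdorffEDist_le_of_mem_edist (key hs) (key hs')

lemma SetTendsto.unique {A : ℝ → Set (Fin d → ℝ)} {l : Filter ℝ} [l.NeBot]
    {L L' : Set (Fin d → ℝ)} (h : SetTendsto A l L) (h' : SetTendsto A l L') : L = L' := by
  rw [← h.1.hausdorffEDist_zero_iff h'.1]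
  refine le_antisymm ?_ zero_le
  have ht : Tendsto (fun s => Metric.hausdorffEDist (A s) L + Metric.hausdorffEDist (A s) L') l
      (𝓝 0) := by simpa using h.2.add h'.2
  refine ge_of_tendsto ht (Eventually.of_forall fun s => ?_)
  rw [Metric.hausdorffEDist_comm (s := A s)]
  exact Metric.hausdorffEDist_triangle

lemma SetTendsto.congr' {A A' : ℝ → Set (Fin d → ℝ)} {l : Filter ℝ} {L : Set (Fin d → ℝ)}
    (h : SetTendsto A l L) (hA : A =ᶠ[l] A') : SetTendsto A' l L :=
  ⟨h.1, h.2.congr' (hA.mono fun s hs => by rw [hs])⟩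

lemma setTendsto_const {L : Set (Fin d → ℝ)} (l : Filter ℝ) (hL : IsClosed L) :
    SetTendsto (fun _ => L) l L :=
  ⟨hL, by simp [tendsto_const_nhds]⟩

lemma IsIteratedLimit.unique {A : ℝ → ℝ → Set (Fin d → ℝ)} {L L' : Set (Fin d → ℝ)}
    (h : IsIteratedLimit A L) (h' : IsIteratedLimit A L') : L = L' := by
  obtain ⟨B, hB, hL⟩ := h
  obtain ⟨B', hB', hL'⟩ := h'
  refine hL.unique (hL'.congr' ?_)
  filter_upwards [self_mem_nhdsWithin] with ε hε
  exact (hB' ε hε).unique (hB ε hε)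

lemma Feasible.setTendsto_slice {z' z'' : Cell d} (h : Feasible m z' z'') {ε : ℝ} (hε : 0 < ε) :
    SetTendsto (slice m z' z'' ε) (𝓝[>] 0) (slice m z' z'' ε 0) := by
  refine setTendsto_of_thickening (isClosed_slice _ _ _ _ _) (fun η hη => ?_) (fun η hη => ?_)
  · have hc : Tendsto (fun δ : ℝ => (ε, δ)) (𝓝[>] 0) (𝓝 (ε, 0)) :=
      (Continuous.tendsto (by fun_prop) 0).mono_left nhdsWithin_le_nhds
    exact hc.eventually (eventually_slice_subset_thickening m z' z'' (ε, 0) hη)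
  · obtain ⟨δ₀, hδ₀, y, hy⟩ := h.exists_slice_nonempty hε
    have hbound : ∀ {S : Cell d} {x : Fin d → ℝ}, x ∈ dualCell S → ‖x‖ ≤ 1 := by
      intro S x hx
      rw [pi_norm_le_iff_of_nonneg zero_le_one]
      intro j
      exact abs_le.2 (dualCell_subset_cube _ hx j)
    -- Moving `x` the fraction `δ / δ₀` of the way to `y` lands in the slice at `δ`; the factor 2
    -- bounds `‖x - y‖` in the cube.
    have hlim : Tendsto (fun δ : ℝ => δ / δ₀ * 2) (𝓝[>] 0) (𝓝 0) := by
      have : Continuous fun δ : ℝ => δ / δ₀ * 2 := by fun_prop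
      simpa using (this.tendsto 0).mono_left nhdsWithin_le_nhds
    have hlt : ∀ᶠ δ : ℝ in 𝓝[>] 0, δ < δ₀ := nhdsWithin_le_nhds (Iio_mem_nhds hδ₀)
    filter_upwards [self_mem_nhdsWithin, hlt, hlim.eventually (Iio_mem_nhds hη)]
      with δ hδ hδ' hδη x hx
    have hδ : 0 < δ := hδ
    have hs : 0 ≤ δ / δ₀ := (div_pos hδ hδ₀).le
    have hs1 : δ / δ₀ ≤ 1 := (div_le_one hδ₀).2 hδ'.le
    have hm := slice_combination hx hy (sub_nonneg.2 hs1) hs (by ring)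
    rw [show (1 - δ / δ₀) * ε + δ / δ₀ * ε = ε by ring,
      show (1 - δ / δ₀) * 0 + δ / δ₀ * δ₀ = δ by rw [div_mul_cancel₀ _ hδ₀.ne']; ring] at hm
    refine Metric.mem_thickening_iff.2 ⟨_, hm, lt_of_le_of_lt ?_ hδη⟩
    rw [dist_eq_norm, show x - ((1 - δ / δ₀) • x + (δ / δ₀) • y) = (δ / δ₀) • (x - y) by module,
      norm_smul, Real.norm_of_nonneg hs]
    refine mul_le_mul_of_nonneg_left ?_ hs
    linarith [norm_sub_le x y, hbound hx.1, hbound hy.1]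

/-- No feasibility is needed here: at `δ = 0` the slices decrease with `ε` and all contain the
limit. -/
lemma setTendsto_slice_zero (m : ℕ) (z' z'' : Cell d) :
    SetTendsto (fun ε => slice m z' z'' ε 0) (𝓝[>] 0) (dualCell z' ∩ dualCell z'') := by
  rw [← slice_zero_zero m]
  refine setTendsto_of_thickening (isClosed_slice _ _ _ _ _) (fun η hη => ?_) (fun η hη => ?_)
  · have hc : Tendsto (fun ε : ℝ => (ε, (0 : ℝ))) (𝓝[>] 0) (𝓝 (0, 0)) :=
      (Continuous.tendsto (by fun_prop) 0).mono_left nhdsWithin_le_nhds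
    exact hc.eventually (eventually_slice_subset_thickening m z' z'' (0, 0) hη)
  · filter_upwards [self_mem_nhdsWithin] with ε hε
    exact (slice_mono (le_of_lt hε)).trans (Metric.self_subset_thickening hη _)

lemma Feasible.isThickIntersection {z' z'' : Cell d} (h : Feasible m z' z'') :
    IsThickIntersection m z' z'' (dualCell z' ∩ dualCell z'') := by
  refine ⟨fun ε => slice m z' z'' ε 0, fun ε hε => ?_, setTendsto_slice_zero m z' z''⟩
  simp only [dualCell_inter_thickDualCell]
  exact h.setTendsto_slice hε

lemma isThickIntersection_empty {z' z'' : Cell d} (h : ¬ Feasible m z' z'') :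
    IsThickIntersection m z' z'' ∅ := by
  refine ⟨fun _ => ∅, fun ε _ => ?_, setTendsto_const _ isClosed_empty⟩
  simp only [dualCell_inter_thickDualCell]
  refine (setTendsto_const _ isClosed_empty).congr' ?_
  filter_upwards [self_mem_nhdsWithin] with δ hδ
  by_contra hne
  exact h ⟨δ, hδ, ε, Set.nonempty_iff_ne_empty.2 (Ne.symm hne)⟩

end Limits

/-! ### Zeros and signs of the polynomials at the nodes. -/

section Polynomials

open Polynomial

variable {d m : ℕ}

lemma node_strictAnti : StrictAnti (node : Fin d → ℝ) := by
  intro i j hij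
  have : (i : ℝ) < j := by exact_mod_cast hij
  exact one_div_lt_one_div_of_lt (by positivity) (by linarith)

lemma node_pos (j : Fin d) : 0 < node j := by
  unfold node
  positivity

lemma node_le_one (j : Fin d) : node j ≤ 1 := by
  unfold node
  rw [div_le_one (by positivity)]
  linarith [show (0 : ℝ) ≤ j by positivity]

/-- The polynomial whose values at the nodes are `shift e δ`. -/
noncomputable def shiftPoly (e : Fin m → ℝ) (δ : ℝ) : ℝ[X] :=
  ∑ i : Fin m, C (e i) * X ^ (i : ℕ) + C δ * X ^ m

lemma eval_shiftPoly (e : Fin m → ℝ) (δ : ℝ) (j : Fin d) :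
    (shiftPoly e δ).eval (node j) = shift e δ j := by
  simp [shiftPoly, shift, eval_finsetSum]

lemma degree_shiftPoly_zero_lt (e : Fin m → ℝ) : (shiftPoly e 0).degree < m := by
  simpa [shiftPoly] using degree_sum_fin_lt e

lemma degree_shiftPoly {e : Fin m → ℝ} {δ : ℝ} (hδ : δ ≠ 0) : (shiftPoly e δ).degree = m := by
  have h := degree_sum_fin_lt e
  rw [← degree_C_mul_X_pow m hδ] at h ⊢
  rw [shiftPoly, degree_add_eq_right_of_degree_lt h]

/-- A polynomial of degree exactly `m` vanishes at no more than `m` nodes. -/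
lemma card_le_of_shift_eq_zero {e : Fin m → ℝ} {δ : ℝ} (hδ : δ ≠ 0) {S : Finset (Fin d)}
    (h : ∀ j ∈ S, shift e δ j = 0) : S.card ≤ m := by
  by_contra! hlt
  have h0 : shiftPoly e δ = 0 := by
    refine eq_zero_of_degree_lt_of_eval_index_eq_zero (s := S) (v := node)
      node_strictAnti.injective.injOn ?_ ?_
    · rw [degree_shiftPoly hδ]
      exact_mod_cast hlt
    · simpa [eval_shiftPoly] using h
  have := degree_shiftPoly (e := e) hδ
  simp [h0] at this

/-- The `c i` are the lower coefficients of the monic nodal polynomial of `S`. -/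
lemma exists_shift_one_eq_prod (S : Finset (Fin d)) (hS : S.card = m) :
    ∃ c : Fin m → ℝ, ∀ k : Fin d, shift c 1 k = ∏ i ∈ S, (node k - node i) := by
  have hd : (Lagrange.nodal S node).natDegree = m := by
    rw [Lagrange.natDegree_nodal, hS]
  refine ⟨fun i => (Lagrange.nodal S node).coeff i, fun k => ?_⟩
  have h := congrArg (eval (node k)) (Lagrange.nodal_monic (s := S) (v := node)).as_sum
  rw [hd, Lagrange.eval_nodal] at h
  rw [h]
  simp [shift, eval_finsetSum, Finset.sum_range, add_comm]

/-- A polynomial of degree `m` that vanishes at `m` nodes is determined by its leading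
coefficient. -/
lemma shift_eq_mul_prod {e : Fin m → ℝ} {δ : ℝ} {S : Finset (Fin d)} (hS : S.card = m)
    (h : ∀ j ∈ S, shift e δ j = 0) (k : Fin d) :
    shift e δ k = δ * ∏ i ∈ S, (node k - node i) := by
  obtain ⟨c, hc⟩ := exists_shift_one_eq_prod S hS
  -- Subtracting `δ` times the nodal polynomial cancels the leading terms and leaves degree below
  -- `m` with `m` zeros, hence zero.
  have hcomb : ∀ j : Fin d, shift ((1 : ℝ) • e + (-δ) • c) 0 j
      = shift e δ j - δ * ∏ i ∈ S, (node j - node i) := by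
    intro j
    have := shift_combination e c δ 1 1 (-δ) j
    rw [hc] at this
    rw [show (1 : ℝ) * δ + -δ * 1 = 0 by ring] at this
    rw [this]
    ring
  have h0 : shiftPoly ((1 : ℝ) • e + (-δ) • c) 0 = 0 := by
    refine eq_zero_of_degree_lt_of_eval_index_eq_zero (s := S) (v := node)
      node_strictAnti.injective.injOn ?_ ?_
    · rw [hS]
      exact degree_shiftPoly_zero_lt _
    · intro j hj
      rw [eval_shiftPoly, hcomb, h j hj, Finset.prod_eq_zero hj (sub_self _)]
      simp
  have := eval_shiftPoly ((1 : ℝ) • e + (-δ) • c) 0 k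
  rw [h0, hcomb, eval_zero] at this
  linarith

lemma signPow_val (n : ℕ) : (signPow n).val = (-1) ^ n := by
  unfold signPow
  split_ifs with h
  · simp [val, h.neg_one_pow]
  · simp [val, (Nat.not_even_iff_odd.1 h).neg_one_pow]

/-- As the nodes decrease, the negative factors are exactly those with `i < k`; each absorbs one
factor `-1`. -/
lemma signPow_val_mul_prod_pos {S : Finset (Fin d)} {k : Fin d} (hk : k ∉ S) :
    0 < (signPow (S.filter fun i => i < k).card).val * ∏ i ∈ S, (node k - node i) := by
  rw [signPow_val, ← Finset.prod_filter_mul_prod_filter_not S (fun i => i < k), ← mul_assoc,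
    ← Finset.prod_const, ← Finset.prod_mul_distrib]
  refine mul_pos (Finset.prod_pos fun i hi => ?_) (Finset.prod_pos fun i hi => ?_)
  · have := node_strictAnti (Finset.mem_filter.1 hi).2
    linarith
  · obtain ⟨hi, hle⟩ := Finset.mem_filter.1 hi
    have hne : k ≠ i := fun h => hk (h ▸ hi)
    exact sub_pos.2 (node_strictAnti (lt_of_le_of_ne (not_lt.1 hle) hne))

/-- This keeps the point built in `feasible_of_signPattern` inside the cube and lets the coordinates
`±1` dominate the shift. -/
lemma abs_prod_node_sub_le_one (S : Finset (Fin d)) (k : Fin d) :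
    |∏ i ∈ S, (node k - node i)| ≤ 1 := by
  rw [Finset.abs_prod]
  refine Finset.prod_le_one (fun _ _ => abs_nonneg _) fun i _ => abs_le.2 ?_
  constructor <;> linarith [node_pos i, node_pos k, node_le_one i, node_le_one k]

end Polynomials

/-! ### Feasibility and the alternating sign pattern. -/

section Feasibility

variable {d m : ℕ}

lemma mem_bullets {z : Cell d} {j : Fin d} : j ∈ bullets z ↔ z j = bullet := by
  simp [bullets]

lemma mem_shared {z' z'' : Cell d} {j : Fin d} :
    j ∈ shared z' z'' ↔ z' j = bullet ∧ z'' j = bullet := by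
  simp [shared, mem_bullets]

lemma mem_unshared {z' z'' : Cell d} {j : Fin d} :
    j ∈ unshared z' z'' ↔ (z' j = bullet ∨ z'' j = bullet) ∧ ¬(z' j = bullet ∧ z'' j = bullet) := by
  simp [unshared, mem_shared, mem_bullets]

lemma signPow_eq (n : ℕ) : signPow n = plus ∨ signPow n = minus := by
  unfold signPow
  split_ifs <;> simp

lemma Feasible.card_shared_le {z' z'' : Cell d} (h : Feasible m z' z'') :
    (shared z' z'').card ≤ m := by
  obtain ⟨δ, hδ, ε, x, hx, e, -, hj⟩ := h
  refine card_le_of_shift_eq_zero (e := e) hδ.ne' fun j hS => ?_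
  rw [mem_shared] at hS
  rw [← (hj j).1 hS.2, (hx j).1 hS.1]

lemma Feasible.signPattern {z' z'' : Cell d} (h : Feasible m z' z'')
    (hr : (shared z' z'').card = m) : SignPattern z' z'' := by
  obtain ⟨δ, hδ, ε, x, hx, e, -, hj⟩ := h
  have hS : ∀ j ∈ shared z' z'', shift e δ j = 0 := by
    intro j hS
    rw [mem_shared] at hS
    rw [← (hj j).1 hS.2, (hx j).1 hS.1]
  intro j hju
  have hjS : j ∉ shared z' z'' := fun h => (mem_unshared.1 hju).2 (mem_shared.1 h)
  have hpos := mul_pos hδ (signPow_val_mul_prod_pos hjS)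
  rw [mul_left_comm, ← shift_eq_mul_prod hr hS j] at hpos
  simp only [position, Nat.add_sub_cancel]
  obtain ⟨hx0, hx1, hx2⟩ := hx j
  obtain ⟨hj0, hj1, hj2⟩ := hj j
  have hnot := (mem_unshared.1 hju).2
  constructor
  -- Here `x j = 0` lies on the `z'' j` side of the nonzero shift, so `z'' j` is opposite to its
  -- sign.
  · intro hz
    rcases hz'' : z'' j with _ | _ | _
    · exact absurd ⟨hz, hz''⟩ hnot
    all_goals
      rcases signPow_eq ((shared z' z'').filter fun i => i < j).card with hs | hs <;>
        rw [hs] at hpos ⊢ <;> simp_all [val, CellLabel.flip]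
      try linarith
  -- Here `x j` equals the shift, so `z' j` is its sign.
  · intro hz
    rcases hz' : z' j with _ | _ | _
    · exact absurd ⟨hz', hz⟩ hnot
    all_goals
      rcases signPow_eq ((shared z' z'').filter fun i => i < j).card with hs | hs <;>
        rw [hs] at hpos ⊢ <;> simp_all [val]
      try linarith

lemma feasible_of_signPattern {z' z'' : Cell d} (hr : (shared z' z'').card = m)
    (hopp : ∀ k, ¬ Opposite (z' k) (z'' k)) (h : SignPattern z' z'') : Feasible m z' z'' := by
  obtain ⟨c, hc⟩ := exists_shift_one_eq_prod (shared z' z'') hr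
  -- Feasibility does not restrict `ε`, so any common bound for the `|c i|` serves. Away from the
  -- bullets of `z''` the coordinate is the extreme value allowed by `z'`.
  refine ⟨1, one_pos, ∑ i, |c i|, fun j => if z'' j = bullet then shift c 1 j else (z' j).val,
    ?_, c, ?_, ?_⟩
  · intro j
    have hb := abs_le.1 (abs_prod_node_sub_le_one (shared z' z'') j)
    rw [← hc] at hb
    by_cases hz'' : z'' j = bullet
    · simp only [hz'', if_true]
      by_cases hz' : z' j = bullet
      · have : shift c 1 j = 0 := by
          rw [hc, Finset.prod_eq_zero (mem_shared.2 ⟨hz', hz''⟩) (sub_self _)]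
        simp [hz', this]
      · have hs := (h j (mem_unshared.2 ⟨Or.inr hz'', fun h => hz' h.1⟩)).2 hz''
        have hpos := signPow_val_mul_prod_pos (S := shared z' z'') (k := j)
          fun h => hz' (mem_shared.1 h).1
        simp only [position, Nat.add_sub_cancel] at hs
        rw [← hs, ← hc] at hpos
        refine ⟨fun h => absurd h hz', fun h => ?_, fun h => ?_⟩
        · rw [h] at hpos
          simp only [val] at hpos
          exact ⟨by linarith, hb.2⟩
        · rw [h] at hpos
          simp only [val] at hpos
          exact ⟨hb.1, by linarith⟩
    · simp only [hz'', if_false]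
      refine ⟨fun h => ?_, fun h => ?_, fun h => ?_⟩ <;> simp [h, val]
  · intro i
    exact abs_le.1 (Finset.single_le_sum (f := fun i => |c i|) (fun _ _ => abs_nonneg _)
      (Finset.mem_univ i))
  · intro j
    have hb := abs_le.1 (abs_prod_node_sub_le_one (shared z' z'') j)
    rw [← hc] at hb
    by_cases hz'' : z'' j = bullet
    · simp [hz'']
    · simp only [hz'', if_false]
      by_cases hz' : z' j = bullet
      · have hs := (h j (mem_unshared.2 ⟨Or.inl hz', fun h => hz'' h.2⟩)).1 hz'
        have hpos := signPow_val_mul_prod_pos (S := shared z' z'') (k := j)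
          fun h => hz'' (mem_shared.1 h).2
        simp only [position, Nat.add_sub_cancel] at hs
        rw [← hc] at hpos
        rcases signPow_eq ((shared z' z'').filter fun i => i < j).card with hs' | hs' <;>
          rw [hs'] at hpos hs <;> simp only [val, CellLabel.flip] at hpos hs
        · simp only [hs, hz', val, reduceCtorEq, false_imp_iff, true_and, forall_const]
          linarith
        · simp only [hs, hz', val, reduceCtorEq, false_imp_iff, true_and, and_true, forall_const]
          linarith
      · have ho := hopp j
        rcases hz1 : z' j with _ | _ | _ <;> rcases hz2 : z'' j with _ | _ | _ <;>
          simp_all [val, CellLabel.Opposite]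

end Feasibility

/-! ### Intersections and dimensions of dual cells. -/

section Dimension

variable {d : ℕ}

/-- The label of the intersection of two dual cells. -/
def meet (z' z'' : Cell d) : Cell d := fun k => if z' k = z'' k then z' k else bullet

/-- Any two distinct sets among `{0}`, `[0,1]`, `[-1,0]` meet only in `0`. -/
lemma dualCell_inter (z' z'' : Cell d) :
    dualCell z' ∩ dualCell z'' = dualCell (meet z' z'') := by
  ext x
  simp only [dualCell, Set.mem_inter_iff, Set.mem_ofPred_eq, ← forall_and]
  refine forall_congr' fun j => ?_
  rcases h1 : z' j with _ | _ | _ <;> rcases h2 : z'' j with _ | _ | _ <;>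
    simp [meet, h1, h2] <;> grind

lemma val_mem_dualCell (z : Cell d) : (fun j => (z j).val) ∈ dualCell z := by
  intro j
  refine ⟨fun h => ?_, fun h => ?_, fun h => ?_⟩ <;> simp [h, val]

/-- The point `(z j).val` of each cell lies in the other. Both inclusions are needed, since the
value `0` of a bullet is allowed by every label. -/
lemma dualCell_injective : Function.Injective (dualCell : Cell d → Set (Fin d → ℝ)) := by
  intro z w h
  have h1 : (fun j => (z j).val) ∈ dualCell w := h ▸ val_mem_dualCell z
  have h2 : (fun j => (w j).val) ∈ dualCell z := h ▸ val_mem_dualCell w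
  funext j
  have h1 := h1 j
  have h2 := h2 j
  rcases hz : z j with _ | _ | _ <;> rcases hw : w j with _ | _ | _ <;>
    simp [hz, hw, val] at h1 h2 ⊢ <;> linarith

lemma vectorSpan_dualCell (z : Cell d) : vectorSpan ℝ (dualCell z) =
    Submodule.span ℝ (Set.range fun j : {j // z j ≠ bullet} =>
      (Pi.single (j : Fin d) (1 : ℝ) : Fin d → ℝ)) := by
  rw [vectorSpan_eq_span_vsub_set_right ℝ (zero_mem_dualCell z)]
  simp only [vsub_eq_sub, sub_zero, Set.image_id']
  refine le_antisymm (Submodule.span_le.2 fun x hx => ?_) (Submodule.span_le.2 ?_)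
  · rw [pi_eq_sum_univ' x]
    refine Submodule.sum_mem _ fun j _ => ?_
    by_cases hj : z j = bullet
    · simp [(hx j).1 hj]
    · exact Submodule.smul_mem _ _ (Submodule.subset_span ⟨⟨j, hj⟩, by
        ext k; simp [Pi.single_apply, eq_comm]⟩)
  · rintro _ ⟨⟨j, hj⟩, rfl⟩
    have hmem : (Pi.single j (z j).val : Fin d → ℝ) ∈ dualCell z := by
      intro k
      by_cases hk : k = j
      · subst hk
        simpa using val_mem_dualCell z k
      · simp [hk]
    have hsq : (Pi.single j (1 : ℝ) : Fin d → ℝ) = (z j).val • Pi.single j (z j).val := by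
      rw [← Pi.single_smul]
      rcases hz : z j with _ | _ | _
      · exact absurd hz hj
      · simp [val]
      · simp [val]
    simp only [SetLike.mem_coe]
    rw [hsq]
    exact Submodule.smul_mem _ _ (Submodule.subset_span hmem)

lemma affineDim_empty : affineDim (∅ : Set (Fin d → ℝ)) = ⊥ := by
  simp [affineDim]

lemma affineDim_dualCell (z : Cell d) :
    affineDim (dualCell z) = (((d : ℤ) - (bullets z).card : ℤ) : WithBot ℤ) := by
  have hli : LinearIndependent ℝ fun j : {j // z j ≠ bullet} =>
      (Pi.single (j : Fin d) (1 : ℝ) : Fin d → ℝ) := by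
    have := (Pi.basisFun ℝ (Fin d)).linearIndependent.comp
      (Subtype.val : {j // z j ≠ bullet} → Fin d) Subtype.val_injective
    convert this using 1
    ext j
    simp
  have hne : dualCell z ≠ ∅ := Set.Nonempty.ne_empty ⟨0, zero_mem_dualCell z⟩
  rw [affineDim, if_neg hne, vectorSpan_dualCell, finrank_span_eq_card hli, Fintype.card_subtype]
  have := Finset.card_filter_add_card_filter_not (s := (Finset.univ : Finset (Fin d)))
    (fun j => z j = bullet)
  rw [Finset.card_univ, Fintype.card_fin] at this
  congr 1
  simp only [bullets]
  have h2 : ((Finset.univ.filter fun j => z j = bullet).card : ℤ) +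
    (Finset.univ.filter fun j => ¬ z j = bullet).card = d := by exact_mod_cast this
  simp only [ne_eq]
  linarith

lemma card_union_bullets (z' z'' : Cell d) :
    ((bullets z' ∪ bullets z'').card : ℤ) =
      (bullets z').card + (bullets z'').card - (shared z' z'').card := by
  have := Finset.card_union_add_card_inter (bullets z') (bullets z'')
  rw [shared]
  omega

lemma bullets_union_subset_meet (z' z'' : Cell d) :
    bullets z' ∪ bullets z'' ⊆ bullets (meet z' z'') := by
  intro j
  simp only [Finset.mem_union, mem_bullets, meet]
  rintro (h | h) <;> split_ifs with he <;> simp_all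

lemma bullets_combine (z' z'' : Cell d) :
    bullets (combine z' z'') = bullets z' ∪ bullets z'' := by
  ext j
  simp only [Finset.mem_union, mem_bullets, combine]
  split_ifs with h
  · simpa using h
  · tauto

lemma meet_eq_combine {z' z'' : Cell d} (h : ∀ k, ¬ Opposite (z' k) (z'' k)) :
    meet z' z'' = combine z' z'' := by
  funext k
  have := h k
  simp only [meet, combine]
  rcases h1 : z' k with _ | _ | _ <;> rcases h2 : z'' k with _ | _ | _ <;> simp_all [CellLabel.Opposite]

lemma card_union_bullets_lt_meet {z' z'' : Cell d} (h : ∃ k, Opposite (z' k) (z'' k)) :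
    (bullets z' ∪ bullets z'').card < (bullets (meet z' z'')).card := by
  obtain ⟨k, hk⟩ := h
  refine Finset.card_lt_card (Finset.ssubset_iff_of_subset (bullets_union_subset_meet z' z'') |>.2
    ⟨k, ?_, ?_⟩)
  · rcases hk with ⟨h1, h2⟩ | ⟨h1, h2⟩ <;> simp [mem_bullets, meet, h1, h2]
  · rcases hk with ⟨h1, h2⟩ | ⟨h1, h2⟩ <;> simp [mem_bullets, h1, h2]

end Dimension

/-! ### The set `Int_m(z)` in terms of the sign pattern. -/

section IntSet

variable {d m : ℕ}

lemma mem_intSet_iff {z z' z'' : Cell d} : (z', z'') ∈ IntSet m z ↔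
    (shared z' z'').card = m ∧ (∀ k, ¬ Opposite (z' k) (z'' k)) ∧ SignPattern z' z'' ∧
      combine z' z'' = z := by
  have hflip : ∀ n, (signPow n).flip ≠ bullet ∧ signPow n ≠ bullet := by
    intro n
    rcases signPow_eq n with h | h <;> simp [h, CellLabel.flip]
  constructor
  · rintro ⟨S, hS, hSb, hj⟩
    -- The set `S` is forced: outside it one of the two labels is always a sign.
    have hSs : shared z' z'' = S := by
      ext j
      rw [mem_shared]
      refine ⟨fun h => ?_, fun h => (hSb j h).2⟩
      by_contra hn
      obtain ⟨h1, h2⟩ := hj j hn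
      by_cases hz : z j = bullet
      · rcases h1 hz with ⟨h3, -⟩ | ⟨-, h3⟩
        · exact (hflip _).2 (h3.symm.trans h.1)
        · exact (hflip _).1 (h3.symm.trans h.2)
      · exact hz ((h2 hz).1.symm.trans h.1)
    subst hSs
    have hno : ∀ k, ¬ Opposite (z' k) (z'' k) := by
      intro k hk
      have hb : z' k ≠ bullet ∧ z'' k ≠ bullet := by
        rcases hk with ⟨h1, h2⟩ | ⟨h1, h2⟩ <;> simp [h1, h2]
      obtain ⟨h1, h2⟩ := hj k fun h => hb.1 (mem_shared.1 h).1
      by_cases hz : z k = bullet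
      · rcases h1 hz with ⟨-, h3⟩ | ⟨h3, -⟩
        · exact hb.2 h3
        · exact hb.1 h3
      · have heq : z' k = z'' k := (h2 hz).1.trans (h2 hz).2.symm
        rw [heq] at hk
        rcases hk with ⟨h1, h2⟩ | ⟨h1, h2⟩ <;> simp [h1] at h2
    refine ⟨hS, hno, ?_, ?_⟩
    · intro j hju
      rw [mem_unshared] at hju
      obtain ⟨h1, h2⟩ := hj j fun h => hju.2 (mem_shared.1 h)
      simp only [position, Nat.add_sub_cancel]
      have hz : z j = bullet := by
        by_contra hz
        have := h2 hz
        rcases hju.1 with h | h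
        · exact hz (this.1.symm.trans h)
        · exact hz (this.2.symm.trans h)
      rcases h1 hz with ⟨h3, h4⟩ | ⟨h3, h4⟩
      · exact ⟨fun h => absurd ⟨h, h4⟩ hju.2, fun _ => h3⟩
      · exact ⟨fun _ => h4, fun h => absurd ⟨h3, h⟩ hju.2⟩
    · funext j
      by_cases hjS : j ∈ shared z' z''
      · have := hSb j hjS
        simp only [] at this
        simp [combine, this]
      · obtain ⟨h1, h2⟩ := hj j hjS
        by_cases hz : z j = bullet
        · rcases h1 hz with ⟨-, h3⟩ | ⟨h3, -⟩
          · have h3 : z'' j = bullet := h3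
            simp [combine, hz, h3]
          · have h3 : z' j = bullet := h3
            simp [combine, hz, h3]
        · have h3 : z' j = z j := (h2 hz).1
          have h4 : z'' j = z j := (h2 hz).2
          simp [combine, h3, h4, hz]
  · rintro ⟨hS, hno, hpat, rfl⟩
    refine ⟨shared z' z'', hS, fun i hi => ?_, fun j hj => ⟨fun hz => ?_, fun hz => ?_⟩⟩
    · have := mem_shared.1 hi
      exact ⟨by simp [combine, this], this⟩
    · have hb : z' j = bullet ∨ z'' j = bullet := by
        rwa [← mem_bullets, bullets_combine, Finset.mem_union, mem_bullets, mem_bullets] at hz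
      have hp := hpat j (mem_unshared.2 ⟨hb, fun h => hj (mem_shared.2 h)⟩)
      simp only [position, Nat.add_sub_cancel] at hp
      rcases hb with h | h
      · exact Or.inr ⟨h, hp.1 h⟩
      · exact Or.inl ⟨hp.2 h, h⟩
    · have := hno j
      simp only [combine] at hz ⊢
      rcases h1 : z' j with _ | _ | _ <;> rcases h2 : z'' j with _ | _ | _ <;>
        simp_all [CellLabel.Opposite]

end IntSet

end CubicalCup

open CubicalCup CubicalCup.CellLabel in
theorem mainTheorem6 (d m p q r : ℕ) (z' z'' : Cell d)
    (hp : (bullets z').card = p) (hq : (bullets z'').card = q)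
    (hr : (shared z' z'').card = r) :
    -- the iterated limit exists and is unique
    (∃! L : Set (Fin d → ℝ), IsThickIntersection m z' z'' L) ∧
    ∀ L : Set (Fin d → ℝ), IsThickIntersection m z' z'' L →
      -- the number of shared bullets is not `m`
      (r ≠ m → L = ∅ ∨ affineDim L < (((d : ℤ) - p - q + m : ℤ) : WithBot ℤ)) ∧
      -- there are opposite signs
      (r = m → (∃ k, Opposite (z' k) (z'' k)) →
        affineDim L < (((d : ℤ) - p - q + m : ℤ) : WithBot ℤ)) ∧
      -- the alternating sign pattern holds
      (r = m → (∀ k, ¬ Opposite (z' k) (z'' k)) → SignPattern z' z'' →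
        L = dualCell (combine z' z'') ∧
        ((bullets (combine z' z'')).card : ℤ) = (p : ℤ) + q - m ∧
        affineDim L = (((d : ℤ) - p - q + m : ℤ) : WithBot ℤ)) ∧
      -- the alternating sign pattern fails
      (r = m → (∀ k, ¬ Opposite (z' k) (z'' k)) → ¬ SignPattern z' z'' → L = ∅) ∧
      -- the full-dimensional case
      (affineDim L = (((d : ℤ) - p - q + m : ℤ) : WithBot ℤ) ↔
        r = m ∧ (∀ k, ¬ Opposite (z' k) (z'' k)) ∧ SignPattern z' z'') ∧
      -- `Int_m(z)` consists of the pairs whose limit is `P^∨_z` in full dimension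
      (∀ z : Cell d, (z', z'') ∈ IntSet m z ↔
        L = dualCell z ∧ affineDim L = (((d : ℤ) - p - q + m : ℤ) : WithBot ℤ)) := by
  subst hp hq hr
  have hcomb := card_union_bullets z' z''
  have hsub : ((bullets z' ∪ bullets z'').card : ℤ) ≤ (bullets (meet z' z'')).card := by
    exact_mod_cast Finset.card_le_card (bullets_union_subset_meet z' z'')
  by_cases hF : Feasible m z' z''
  · have hlim := hF.isThickIntersection
    rw [dualCell_inter] at hlim
    refine ⟨⟨_, hlim, fun L hL => hL.unique hlim⟩, fun L hL => ?_⟩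
    obtain rfl : L = dualCell (meet z' z'') := hL.unique hlim
    have hle := hF.card_shared_le
    have hpat := hF.signPattern
    have hlt : (∃ k, Opposite (z' k) (z'' k)) →
        ((bullets z' ∪ bullets z'').card : ℤ) < (bullets (meet z' z'')).card := fun h => by
      exact_mod_cast card_union_bullets_lt_meet h
    have hfull : affineDim (dualCell (meet z' z'')) =
        (((d : ℤ) - (bullets z').card - (bullets z'').card + m : ℤ) : WithBot ℤ) ↔
        (shared z' z'').card = m ∧ (∀ k, ¬ Opposite (z' k) (z'' k)) ∧ SignPattern z' z'' := by
      rw [affineDim_dualCell, WithBot.coe_inj]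
      constructor
      · intro h
        -- Full dimension gives the meet `p + q - m` bullets, at least the `p + q - r` of the union,
        -- so `r ≥ m`; feasibility gives `r ≤ m`.
        have hr : (shared z' z'').card = m := by omega
        refine ⟨hr, fun k hk => ?_, hpat hr⟩
        have := hlt ⟨k, hk⟩
        omega
      · rintro ⟨hr, hno, -⟩
        rw [meet_eq_combine hno, bullets_combine]
        omega
    refine ⟨fun hr => Or.inr ?_, fun hr hopp => ?_, fun hr hno hp => ⟨?_, ?_, ?_⟩,
      fun hr _ hp => absurd (hpat hr) hp, hfull, fun z => ?_⟩
    · rw [affineDim_dualCell, WithBot.coe_lt_coe]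
      omega
    · rw [affineDim_dualCell, WithBot.coe_lt_coe]
      have := hlt hopp
      omega
    · rw [meet_eq_combine hno]
    · rw [bullets_combine, hcomb, hr]
    · exact hfull.2 ⟨hr, hno, hp⟩
    · rw [hfull, mem_intSet_iff]
      constructor
      · rintro ⟨hr, hno, hp, rfl⟩
        exact ⟨by rw [meet_eq_combine hno], hr, hno, hp⟩
      · rintro ⟨hz, hr, hno, hp⟩
        exact ⟨hr, hno, hp, by rw [← meet_eq_combine hno]; exact dualCell_injective hz⟩
  · have hlim := isThickIntersection_empty hF
    have hbad : ¬ ((shared z' z'').card = m ∧ (∀ k, ¬ Opposite (z' k) (z'' k)) ∧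
        SignPattern z' z'') := fun h => hF (feasible_of_signPattern h.1 h.2.1 h.2.2)
    refine ⟨⟨_, hlim, fun L hL => hL.unique hlim⟩, fun L hL => ?_⟩
    obtain rfl : L = ∅ := hL.unique hlim
    rw [affineDim_empty]
    refine ⟨fun _ => Or.inl rfl, fun _ _ => WithBot.bot_lt_coe _,
      fun hr hno hp => absurd ⟨hr, hno, hp⟩ hbad, fun _ _ _ => rfl,
      ⟨fun h => absurd h WithBot.bot_ne_coe, fun h => absurd h hbad⟩, fun z => ⟨fun h => ?_,
        fun h => absurd h.2 WithBot.bot_ne_coe⟩⟩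
    obtain ⟨hr, hno, hp, -⟩ := mem_intSet_iff.1 h
    exact absurd ⟨hr, hno, hp⟩ hbad
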